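/- Let $K$ be a field, let $R=K[X_1,\dots,X_n]$ be the polynomial ring with the standard grading, let $R_+=(X_1,\dots,X_n)$, and let $M=\bigoplus_{i\in\mathbb Z}M_i$ be a finitely generated graded $R$-module. For a set $\mathcal X\subseteq\mathbb N$ and an integer $m$, a finitely generated graded $R$-module $N$ is called $m$-regular with respect to $\mathcal X$ if $H^i_{R_+}(N)_j=0$ for all $i\in\mathcal X$ and all $j>m-i$, where $H^i_{R_+}$ denotes graded local cohomology; $\operatorname{reg}^{\mathcal X}(N)$ is the least such $m$, with $\operatorname{reg}^{\mathcal X}(N)=-\infty$ if $N$ is $m$-regular with respect to $\mathcal X$ for every integer $m$. Put $\mathcal X+1=\{i+1\mid i\in\mathcal X\}$. Let $D\ge 1$ and let $l\in R$ be a homogeneous element of degree $D$ that is filter regular on $M$, that is, multiplication by $l$ from $M_{i-D}$ to $M_i$ is injective for all $i\gg0$. Then for every set $\mathcal X\subseteq\{0,\dots,n\}$: 1. $\operatorname{reg}^{\mathcal X+1}(M)\le\operatorname{reg}^{\mathcal X\cup(\mathcal X+1)}(M/lM)-D+1$; 2. $\operatorname{reg}^{\mathcal X}(M/lM)-D+1\le\operatorname{reg}^{\mathcal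 X\cup(\mathcal X+1)}(M)$. -/

import Mathlib

open scoped Pointwise

namespace GradedLocalCohomology

/-- `M = ⨁ (ℳ i)`, `i : ℤ`, is a graded module over `K[X_1, …, X_n]` with the standard grading.
Since constants are homogeneous of degree `0`, every `ℳ i` is then a `K`-subspace. -/
structure IsGradedModule {K : Type*} [Field K] {n : ℕ} {M : Type*} [AddCommGroup M]
    [Module (MvPolynomial (Fin n) K) M] (ℳ : ℤ → AddSubgroup M) : Prop where
  isInternal : DirectSum.IsInternal ℳ
  smul_mem : ∀ (d : ℕ) (i : ℤ) (f : MvPolynomial (Fin n) K) (m : M),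
    f.IsHomogeneous d → m ∈ ℳ i → f • m ∈ ℳ (i + d)

/-- The grading induced on a quotient `M ⧸ N`: its degree `i` part is the image of `ℳ i`. -/
def quotientGrading {R M : Type*} [CommRing R] [AddCommGroup M] [Module R M]
    (ℳ : ℤ → AddSubgroup M) (N : Submodule R M) (i : ℤ) : AddSubgroup (M ⧸ N) :=
  (ℳ i).map N.mkQ.toAddMonoidHom

/-- `l` is homogeneous of degree `D` and multiplication by `l` from `ℳ (i - D)` to `ℳ i` is
injective for all `i ≫ 0`. -/
def IsFilterRegular {K : Type*} [Field K] {n : ℕ} {M : Type*} [AddCommGroup M]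
    [Module (MvPolynomial (Fin n) K) M] (ℳ : ℤ → AddSubgroup M)
    (l : MvPolynomial (Fin n) K) (D : ℕ) : Prop :=
  l.IsHomogeneous D ∧
    ∀ᶠ i : ℤ in Filter.atTop, Set.InjOn (fun m : M => l • m) (ℳ (i - D) : Set M)

/-! ### The Čech complex on the variables

`C^i = ∏_{#S = i} M[1 / ∏_{k ∈ S} X_k]`, the product over the `i`-element subsets `S` of the set
of variables. Its cohomology is the local cohomology of `M` with support in `(X_1, …, X_n)`. -/

/-- The monomials (with coefficient `1`) in the variables `X_k`, `k ∈ S`. -/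
noncomputable def monomials (K : Type*) [Field K] {n : ℕ} (S : Finset (Fin n)) :
    Submonoid (MvPolynomial (Fin n) K) :=
  Submonoid.closure (MvPolynomial.X '' (S : Set (Fin n)))

theorem monomials_mono (K : Type*) [Field K] {n : ℕ} {S T : Finset (Fin n)} (h : S ⊆ T) :
    monomials K S ≤ monomials K T :=
  Submonoid.closure_mono (Set.image_mono (Finset.coe_subset.2 h))

section Cech

variable (K : Type*) [Field K] {n : ℕ} (M : Type*) [AddCommGroup M]
  [Module (MvPolynomial (Fin n) K) M]

/-- The localization of `M` at the product of the variables `X_k`, `k ∈ S`. -/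
abbrev Loc (S : Finset (Fin n)) : Type _ := LocalizedModule (monomials K S) M

/-- The localization map `M_S → M_T` for `S ⊆ T`. -/
noncomputable def res {S T : Finset (Fin n)} (h : S ⊆ T) :
    Loc K M S →ₗ[MvPolynomial (Fin n) K] Loc K M T :=
  IsLocalizedModule.liftOfLE (monomials K S) (monomials K T) (monomials_mono K h)
    (LocalizedModule.mkLinearMap (monomials K S) M)
    (LocalizedModule.mkLinearMap (monomials K T) M)

/-- Čech cochains of degree `i`. -/
abbrev Cochain (i : ℕ) : Type _ :=
  (S : {S : Finset (Fin n) // S.card = i}) → Loc K M S.1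

/-- The Čech differential
`(d c)_T = ∑_{k ∈ T} (-1)^{#{a ∈ T : a < k}} c_{T \ {k}}`, restricted to `M_T`. -/
noncomputable def differential (i : ℕ) :
    Cochain K (n := n) M i →ₗ[MvPolynomial (Fin n) K] Cochain K (n := n) M (i + 1) :=
  LinearMap.pi fun T => ∑ k : {k // k ∈ T.1},
    (-1 : MvPolynomial (Fin n) K) ^ (T.1.filter (· < k.1)).card •
      (res K M (Finset.erase_subset k.1 T.1)) ∘ₗ
        LinearMap.proj (⟨T.1.erase k.1, by
          rw [Finset.card_erase_of_mem k.2, T.2, Nat.add_sub_cancel]⟩ :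
          {S : Finset (Fin n) // S.card = i})

/-- Čech cocycles. -/
noncomputable def cocycles (i : ℕ) :
    Submodule (MvPolynomial (Fin n) K) (Cochain K (n := n) M i) :=
  LinearMap.ker (differential K M i)

/-- Čech coboundaries. -/
noncomputable def coboundaries :
    (i : ℕ) → Submodule (MvPolynomial (Fin n) K) (Cochain K (n := n) M i)
  | 0 => ⊥
  | i + 1 => LinearMap.range (differential K M i)

/-- The local cohomology module `H^i(M)` with support in `(X_1, …, X_n)`:
Čech cocycles modulo Čech coboundaries. -/
abbrev LocalCohomology (i : ℕ) : Type _ :=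
  (cocycles K (n := n) M i) ⧸ (coboundaries K (n := n) M i).submoduleOf (cocycles K M i)

end Cech

section Grading

variable {K : Type*} [Field K] {n : ℕ} {M : Type*} [AddCommGroup M]
  [Module (MvPolynomial (Fin n) K) M]

/-- `z ∈ M_S` is of degree `j`: it is a fraction `m / s` with `s` a monomial of degree `d` in
the variables of `S` and `m ∈ ℳ (j + d)`. -/
def IsHomogeneousLoc (ℳ : ℤ → AddSubgroup M) (S : Finset (Fin n)) (j : ℤ) (z : Loc K M S) :
    Prop :=
  ∃ (d : ℕ) (s : monomials K S) (m : M),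
    (s : MvPolynomial (Fin n) K).IsHomogeneous d ∧ m ∈ ℳ (j + d) ∧ z = LocalizedModule.mk m s

/-- A Čech cochain is of degree `j` if all of its components are of degree `j`. -/
def IsHomogeneousCochain (ℳ : ℤ → AddSubgroup M) {i : ℕ} (j : ℤ) (c : Cochain K (n := n) M i) :
    Prop :=
  ∀ S : {S : Finset (Fin n) // S.card = i}, IsHomogeneousLoc ℳ S.1 j (c S)

/-- The degree `j` part of the graded module `H^i(M)`: the classes of the cocycles of
degree `j`. -/
def cohomologyPart (ℳ : ℤ → AddSubgroup M) (i : ℕ) (j : ℤ) :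
    Set (LocalCohomology K (n := n) M i) :=
  {ξ | ∃ c : cocycles K (n := n) M i,
    IsHomogeneousCochain ℳ j (c : Cochain K (n := n) M i) ∧ Submodule.Quotient.mk c = ξ}

variable (K n) in
/-- `M` is `m`-regular with respect to `𝒳`: `H^i(M)_j = 0` for all `i ∈ 𝒳` and `j > m - i`. -/
def IsRegularWrt (ℳ : ℤ → AddSubgroup M) (𝒳 : Set ℕ) (m : ℤ) : Prop :=
  ∀ i ∈ 𝒳, ∀ j : ℤ, m - i < j → ∀ ξ ∈ cohomologyPart (K := K) (n := n) ℳ i j, ξ = 0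

variable (K n) in
/-- The regularity of `M` with respect to `𝒳`: the least `m : ℤ` for which `M` is `m`-regular with
respect to `𝒳`. It is `⊥ = -∞` if `M` is `m`-regular with respect to `𝒳` for every `m`. -/
noncomputable def regularity (ℳ : ℤ → AddSubgroup M) (𝒳 : Set ℕ) : EReal :=
  sInf ((fun m : ℤ => ((m : ℝ) : EReal)) '' {m | IsRegularWrt K n ℳ 𝒳 m})

end Grading

end GradedLocalCohomology

/-! Filter regularity makes the kernel of `l` on `M` torsion for every variable, so `l` is injective
on `M_S` for nonempty `S`, hence on Čech cochains of positive degree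
(`cochain_smul_injective_of_isFilterRegular`). This suffices to chase the exact pieces H^i(M)_j →
H^i(M/lM)_j → H^{i+1}(M)_{j-D} → H^{i+1}(M)_j on cochains, even for i = 0, where `l` need not be
injective on `M` itself.

For the first bound, vanishing of H^i(M/lM)_{j+D} makes `l` injective on H^{i+1}(M)_j
(`mem_coboundaries_of_smul_mem`). A power of `l` kills each class of positive cohomological degree
(`exists_pow_smul_mem_coboundaries`), so injectivity in all higher degrees forces the class to
vanish. For the second bound, the outer terms around H^i(M/lM)_j vanish (`IsRegularWrt.quotient`).
-/

namespace GradedLocalCohomology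

/-! ### Localizations at sets of variables -/

section Localization

variable {K : Type*} [Field K] {n : ℕ} {M : Type*} [AddCommGroup M]
  [Module (MvPolynomial (Fin n) K) M]

theorem res_mk {S T : Finset (Fin n)} (h : S ⊆ T) (m : M) (s : monomials K S) :
    res K M h (LocalizedModule.mk m s) =
      LocalizedModule.mk m ⟨s.1, monomials_mono K h s.2⟩ := by
  rw [IsLocalizedModule.mk_eq_mk', IsLocalizedModule.mk_eq_mk']
  exact IsLocalizedModule.liftOfLE_mk' _ _ _ _ _ m s

theorem res_res {S T U : Finset (Fin n)} (h : S ⊆ T) (h' : T ⊆ U) (z : Loc K M S) :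
    res K M h' (res K M h z) = res K M (h.trans h') z := by
  induction z using LocalizedModule.induction_on with
  | h m s => simp only [res_mk]

theorem mk_eq_zero_iff {S : Finset (Fin n)} (m : M) (s : monomials K S) :
    (LocalizedModule.mk m s : Loc K M S) = 0 ↔ ∃ u ∈ monomials K S, u • m = 0 := by
  rw [IsLocalizedModule.mk_eq_mk', IsLocalizedModule.mk'_eq_zero']
  exact ⟨fun ⟨u, hu⟩ => ⟨u.1, u.2, hu⟩, fun ⟨u, hu, h⟩ => ⟨⟨u, hu⟩, h⟩⟩

theorem mk_smul_mul {S : Finset (Fin n)} {t : MvPolynomial (Fin n) K} (ht : t ∈ monomials K S)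
    (m : M) (s : monomials K S) :
    (LocalizedModule.mk (t • m) (⟨t, ht⟩ * s) : Loc K M S) = LocalizedModule.mk m s :=
  LocalizedModule.mk_cancel_common_left ⟨t, ht⟩ s m

theorem X_mem_monomials {S : Finset (Fin n)} {k : Fin n} (hk : k ∈ S) :
    (MvPolynomial.X k : MvPolynomial (Fin n) K) ∈ monomials K S :=
  Submonoid.subset_closure ⟨k, hk, rfl⟩

theorem exists_eq_X_pow_mul_of_mem_monomials_insert {S : Finset (Fin n)} {k : Fin n}
    {u : MvPolynomial (Fin n) K} (hu : u ∈ monomials K (insert k S)) :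
    ∃ (N : ℕ), ∃ t ∈ monomials K S, u = MvPolynomial.X k ^ N * t := by
  rw [monomials, Finset.coe_insert, Set.image_insert_eq, Set.insert_eq, Submonoid.closure_union,
    Submonoid.mem_sup] at hu
  obtain ⟨y, hy, t, ht, rfl⟩ := hu
  obtain ⟨N, rfl⟩ := Submonoid.mem_closure_singleton.1 hy
  exact ⟨N, t, ht, rfl⟩

/-- `M_T` is `M_S` with `X_k` inverted, so the kernel of restriction is `X_k`-power torsion. The
next lemma is the matching clearing of denominators. -/
theorem exists_X_pow_smul_eq_zero_of_res_eq_zero {S T : Finset (Fin n)} {k : Fin n}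
    (hT : T = insert k S) (h : S ⊆ T) (z : Loc K M S) (hz : res K M h z = 0) :
    ∃ N : ℕ, (MvPolynomial.X k : MvPolynomial (Fin n) K) ^ N • z = 0 := by
  subst hT
  induction z using LocalizedModule.induction_on with
  | h m s =>
    rw [res_mk, mk_eq_zero_iff] at hz
    obtain ⟨u, hu, hum⟩ := hz
    obtain ⟨N, t, ht, rfl⟩ := exists_eq_X_pow_mul_of_mem_monomials_insert hu
    refine ⟨N, ?_⟩
    rw [LocalizedModule.smul'_mk, mk_eq_zero_iff]
    exact ⟨t, ht, by rw [smul_smul, mul_comm, hum]⟩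

theorem exists_res_eq_X_pow_smul {S T : Finset (Fin n)} {k : Fin n}
    (hT : T = insert k S) (h : S ⊆ T) (z : Loc K M T) :
    ∃ N : ℕ, ∃ w : Loc K M S,
      res K M h w = (MvPolynomial.X k : MvPolynomial (Fin n) K) ^ N • z := by
  subst hT
  induction z using LocalizedModule.induction_on with
  | h m s =>
    obtain ⟨u, hu⟩ := s
    obtain ⟨N, t, ht, rfl⟩ := exists_eq_X_pow_mul_of_mem_monomials_insert hu
    refine ⟨N, LocalizedModule.mk m ⟨t, ht⟩, ?_⟩
    rw [res_mk, LocalizedModule.smul'_mk]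
    exact (mk_smul_mul (pow_mem (X_mem_monomials (Finset.mem_insert_self k S)) N) m
      ⟨t, monomials_mono K h ht⟩).symm

theorem exists_isHomogeneous_of_mem_monomials {S : Finset (Fin n)}
    {s : MvPolynomial (Fin n) K} (hs : s ∈ monomials K S) :
    s ≠ 0 ∧ s.IsHomogeneous s.totalDegree := by
  suffices h : s ≠ 0 ∧ ∃ d, s.IsHomogeneous d by
    obtain ⟨h0, d, hd⟩ := h
    exact ⟨h0, (hd.totalDegree h0).symm ▸ hd⟩
  induction hs using Submonoid.closure_induction with
  | mem x hx =>
    obtain ⟨k, -, rfl⟩ := hx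
    exact ⟨MvPolynomial.X_ne_zero k, 1, MvPolynomial.isHomogeneous_X K k⟩
  | one => exact ⟨one_ne_zero, 0, MvPolynomial.isHomogeneous_one _ _⟩
  | mul x y _ _ hx hy =>
    obtain ⟨hx0, d, hd⟩ := hx
    obtain ⟨hy0, e, he⟩ := hy
    exact ⟨mul_ne_zero hx0 hy0, d + e, hd.mul he⟩

end Localization

/-! ### Functoriality and exactness of localization -/

section Functoriality

variable {K : Type*} [Field K] {n : ℕ} {M N : Type*} [AddCommGroup M]
  [Module (MvPolynomial (Fin n) K) M] [AddCommGroup N] [Module (MvPolynomial (Fin n) K) N]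

/-- The localization of a linear map. -/
noncomputable def locMap (f : M →ₗ[MvPolynomial (Fin n) K] N) (S : Finset (Fin n)) :
    Loc K M S →ₗ[MvPolynomial (Fin n) K] Loc K N S :=
  IsLocalizedModule.map (monomials K S) (LocalizedModule.mkLinearMap _ M)
    (LocalizedModule.mkLinearMap _ N) f

theorem locMap_mk (f : M →ₗ[MvPolynomial (Fin n) K] N) {S : Finset (Fin n)} (m : M)
    (s : monomials K S) :
    locMap f S (LocalizedModule.mk m s) = LocalizedModule.mk (f m) s :=
  IsLocalizedModule.map_LocalizedModules _ f m s

theorem locMap_res (f : M →ₗ[MvPolynomial (Fin n) K] N) {S T : Finset (Fin n)} (h : S ⊆ T)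
    (z : Loc K M S) : locMap f T (res K M h z) = res K N h (locMap f S z) := by
  induction z using LocalizedModule.induction_on with
  | h m s => simp only [res_mk, locMap_mk]

theorem locMap_surjective {f : M →ₗ[MvPolynomial (Fin n) K] N} (hf : Function.Surjective f)
    (S : Finset (Fin n)) : Function.Surjective (locMap f S) :=
  IsLocalizedModule.map_surjective _ _ _ f hf

theorem locMap_mkQ_eq_zero_iff (l : MvPolynomial (Fin n) K) {S : Finset (Fin n)}
    (z : Loc K M S) :
    locMap (l • (⊤ : Submodule (MvPolynomial (Fin n) K) M)).mkQ S z = 0 ↔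
      ∃ w : Loc K M S, z = l • w := by
  constructor
  · induction z using LocalizedModule.induction_on with
    | h m s =>
      intro h
      rw [locMap_mk, mk_eq_zero_iff] at h
      obtain ⟨u, hu, h⟩ := h
      rw [← map_smul, Submodule.mkQ_apply, Submodule.Quotient.mk_eq_zero,
        Submodule.mem_smul_pointwise_iff_exists] at h
      obtain ⟨m', -, h⟩ := h
      exact ⟨LocalizedModule.mk m' (⟨u, hu⟩ * s), by
        rw [LocalizedModule.smul'_mk, h, mk_smul_mul]⟩
  · rintro ⟨w, rfl⟩
    induction w using LocalizedModule.induction_on with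
    | h m s =>
      rw [LocalizedModule.smul'_mk, locMap_mk, mk_eq_zero_iff]
      refine ⟨1, one_mem _, ?_⟩
      rw [one_smul, Submodule.mkQ_apply, Submodule.Quotient.mk_eq_zero]
      exact Submodule.smul_mem_pointwise_smul m l ⊤ trivial

end Functoriality

/-! ### The Čech complex and torsion of its cohomology -/

section Cochains

variable {K : Type*} [Field K] {n : ℕ} {M : Type*} [AddCommGroup M]
  [Module (MvPolynomial (Fin n) K) M]

theorem differential_apply {i : ℕ} (c : Cochain K (n := n) M i)
    (T : {S : Finset (Fin n) // S.card = i + 1}) :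
    differential K M i c T = ∑ k : {k // k ∈ T.1},
      (-1 : MvPolynomial (Fin n) K) ^ (T.1.filter (· < k.1)).card •
        res K M (Finset.erase_subset k.1 T.1) (c ⟨T.1.erase k.1, by
          rw [Finset.card_erase_of_mem k.2, T.2, Nat.add_sub_cancel]⟩) := by
  simp [differential]

/-- A cochain, extended by zero to all subsets of the set of variables. -/
noncomputable def extend {i : ℕ} (c : Cochain K (n := n) M i) (S : Finset (Fin n)) : Loc K M S :=
  if h : S.card = i then c ⟨S, h⟩ else 0

theorem extend_apply {i : ℕ} (c : Cochain K (n := n) M i) {S : Finset (Fin n)}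
    (h : S.card = i) : extend c S = c ⟨S, h⟩ := dif_pos h

theorem differential_eq_sum {i : ℕ} (c : Cochain K (n := n) M i) {T : Finset (Fin n)}
    (hT : T.card = i + 1) :
    differential K M i c ⟨T, hT⟩ = ∑ k ∈ T,
      (-1 : MvPolynomial (Fin n) K) ^ (T.filter (· < k)).card •
        res K M (Finset.erase_subset k T) (extend c (T.erase k)) := by
  rw [differential_apply, ← Finset.sum_coe_sort T]
  refine Finset.sum_congr rfl fun k _ => ?_
  rw [extend_apply]

theorem res_extend_congr {i : ℕ} (c : Cochain K (n := n) M i) {S S' T : Finset (Fin n)}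
    (h : S = S') (hS : S ⊆ T) (hS' : S' ⊆ T) :
    res K M hS (extend c S) = res K M hS' (extend c S') := by
  subst h; rfl

/-- Deleting the smaller index lowers the position of the larger by one, while deleting the larger
leaves the smaller in place. Hence the two orders of deletion carry opposite signs. -/
theorem neg_one_pow_card_filter_erase {T : Finset (Fin n)} {a b : Fin n} (ha : a ∈ T)
    (hab : a < b) :
    (-1 : MvPolynomial (Fin n) K) ^ (T.filter (· < a)).card *
        (-1) ^ ((T.erase a).filter (· < b)).card +
      (-1) ^ (T.filter (· < b)).card * (-1) ^ ((T.erase b).filter (· < a)).card = 0 := by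
  have h1 : ((T.erase a).filter (· < b)).card + 1 = (T.filter (· < b)).card := by
    rw [Finset.filter_erase, Finset.card_erase_add_one]
    simp [ha, hab]
  have h2 : (T.erase b).filter (· < a) = T.filter (· < a) := by
    rw [Finset.filter_erase, Finset.erase_eq_of_notMem]
    simp [hab.le]
  rw [h2, ← h1, pow_succ]
  ring

theorem differential_differential {i : ℕ} (c : Cochain K (n := n) M i) :
    differential K M (i + 1) (differential K M i c) = 0 := by
  funext ⟨T, hT⟩
  rw [differential_eq_sum]
  have key : ∀ k ∈ T, (-1 : MvPolynomial (Fin n) K) ^ (T.filter (· < k)).card •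
        res K M (Finset.erase_subset k T) (extend (differential K M i c) (T.erase k)) =
      ∑ k' ∈ T.erase k, ((-1 : MvPolynomial (Fin n) K) ^ (T.filter (· < k)).card *
        (-1) ^ ((T.erase k).filter (· < k')).card) •
        res K M ((Finset.erase_subset k' _).trans (Finset.erase_subset k T))
          (extend c ((T.erase k).erase k')) := by
    intro k hk
    have hc : (T.erase k).card = i + 1 := by
      rw [Finset.card_erase_of_mem hk, hT, Nat.add_sub_cancel]
    rw [extend_apply _ hc, differential_eq_sum, map_sum, Finset.smul_sum]
    refine Finset.sum_congr rfl fun k' _ => ?_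
    rw [map_smul, res_res, smul_smul]
  rw [Finset.sum_congr rfl key, Finset.sum_sigma', Pi.zero_apply]
  have cancel : ∀ a b : Fin n, a ∈ T → b ∈ T → a ≠ b →
      ((-1 : MvPolynomial (Fin n) K) ^ (T.filter (· < a)).card *
        (-1) ^ ((T.erase a).filter (· < b)).card) •
        res K M ((Finset.erase_subset b _).trans (Finset.erase_subset a T))
          (extend c ((T.erase a).erase b)) +
      ((-1 : MvPolynomial (Fin n) K) ^ (T.filter (· < b)).card *
        (-1) ^ ((T.erase b).filter (· < a)).card) •
        res K M ((Finset.erase_subset a _).trans (Finset.erase_subset b T))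
          (extend c ((T.erase b).erase a)) = 0 := by
    intro a b ha hb hab
    rw [res_extend_congr c (Finset.erase_right_comm (s := T) (a := b) (b := a)) _
      ((Finset.erase_subset b _).trans (Finset.erase_subset a T)), ← add_smul]
    rcases lt_or_gt_of_ne hab with h | h
    · rw [neg_one_pow_card_filter_erase ha h, zero_smul]
    · rw [add_comm, neg_one_pow_card_filter_erase hb h, zero_smul]
  -- Swapping the order of the two deletions pairs off the terms of the double sum.
  refine Finset.sum_involution (fun p _ => ⟨p.2, p.1⟩) ?_ ?_ ?_ ?_
  · rintro ⟨a, b⟩ h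
    simp only [Finset.mem_sigma, Finset.mem_erase] at h
    exact cancel a b h.1 h.2.2 h.2.1.symm
  · rintro ⟨a, b⟩ h - h'
    simp only [Finset.mem_sigma, Finset.mem_erase] at h
    simp only [Sigma.mk.injEq, heq_eq_eq] at h'
    exact h.2.1 h'.1
  · rintro ⟨a, b⟩ h
    simp only [Finset.mem_sigma, Finset.mem_erase] at h ⊢
    exact ⟨h.2.2, h.2.1.symm, h.1⟩
  · rintro ⟨a, b⟩ h
    rfl

/-- Some power of each variable turns a cocycle of positive degree into a coboundary. -/
theorem exists_X_pow_smul_mem_coboundaries {i : ℕ} (c : Cochain K (n := n) M (i + 1))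
    (hc : c ∈ cocycles K M (i + 1)) (k : Fin n) :
    ∃ N : ℕ, (MvPolynomial.X k : MvPolynomial (Fin n) K) ^ N • c ∈ coboundaries K M (i + 1) := by
  classical
  have lift : ∀ S : {S : Finset (Fin n) // S.card = i}, ∃ N : ℕ, ∃ w : Loc K M S.1, k ∉ S.1 →
      res K M (Finset.subset_insert k S.1) w =
        (MvPolynomial.X k : MvPolynomial (Fin n) K) ^ N • extend c (insert k S.1) := by
    intro S
    obtain ⟨N, w, h⟩ := exists_res_eq_X_pow_smul rfl (Finset.subset_insert k S.1)
      (extend c (insert k S.1))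
    exact ⟨N, w, fun _ => h⟩
  choose ν w hw using lift
  set N := Finset.univ.sup ν
  have hν : ∀ S, ν S ≤ N := fun S => Finset.le_sup (Finset.mem_univ S)
  -- The contracting homotopy that exists once `X_k` is inverted, `c ↦ (± c_{S ∪ {k}})_S`, with
  -- denominators cleared by the common power `X_k ^ N`.
  let b : Cochain K (n := n) M i := fun S =>
    if k ∈ S.1 then 0 else
      (-1 : MvPolynomial (Fin n) K) ^ (S.1.filter (· < k)).card •
        (MvPolynomial.X k : MvPolynomial (Fin n) K) ^ (N - ν S) • w S
  set c' := (MvPolynomial.X k : MvPolynomial (Fin n) K) ^ N • c - differential K M i b with hc'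
  have hdc' : differential K M (i + 1) c' = 0 := by
    rw [hc', map_sub, map_smul, differential_differential, LinearMap.mem_ker.1 hc, smul_zero,
      sub_zero]
  -- When `k ∈ T`, only the face `T \ {k}` contributes to `(d b)_T`, and it reproduces `X_k ^ N •
  -- c_T`.
  have hc'k : ∀ T : Finset (Fin n), k ∈ T → extend c' T = 0 := by
    intro T hkT
    by_cases hT : T.card = i + 1
    · rw [extend_apply _ hT, hc', Pi.sub_apply, sub_eq_zero, differential_eq_sum,
        Finset.sum_eq_single_of_mem k hkT]
      · have hk : k ∉ T.erase k := Finset.notMem_erase k T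
        have hcard : (T.erase k).card = i := by
          rw [Finset.card_erase_of_mem hkT, hT, Nat.add_sub_cancel]
        have hs : (T.erase k).filter (· < k) = T.filter (· < k) := by
          rw [Finset.filter_erase, Finset.erase_eq_of_notMem]
          simp
        have hins : insert k (T.erase k) = T := Finset.insert_erase hkT
        have hwT : res K M (Finset.erase_subset k T) (w ⟨T.erase k, hcard⟩) =
            (MvPolynomial.X k : MvPolynomial (Fin n) K) ^ ν ⟨T.erase k, hcard⟩ • c ⟨T, hT⟩ := by
          have := hw ⟨T.erase k, hcard⟩ hk
          have h2 := congrArg (res K M hins.subset) this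
          rw [res_res, map_smul, res_extend_congr c hins _ subset_rfl, extend_apply c hT] at h2
          rw [h2]
          congr 1
          induction c ⟨T, hT⟩ using LocalizedModule.induction_on with
          | h m s => rw [res_mk]
        rw [extend_apply _ hcard]
        simp only [b, if_neg hk]
        rw [map_smul, map_smul, hwT, hs, smul_smul, ← pow_add, Even.neg_one_pow ⟨_, rfl⟩,
          one_smul, smul_smul, ← pow_add, Nat.sub_add_cancel (hν _)]
        rfl
      · intro a ha hak
        have hcard : (T.erase a).card = i := by
          rw [Finset.card_erase_of_mem ha, hT, Nat.add_sub_cancel]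
        have hk : k ∈ T.erase a := Finset.mem_erase.2 ⟨hak.symm, hkT⟩
        rw [extend_apply _ hcard]
        simp only [b, if_pos hk, map_zero, smul_zero]
    · exact dif_neg hT
  -- In the cocycle equation at `T ∪ {k}`, every face containing `k` vanishes, leaving only the
  -- restriction of `c'_T`.
  have hres : ∀ T : {S : Finset (Fin n) // S.card = i + 1},
      res K M (Finset.subset_insert k T.1) (c' T) = 0 := by
    rintro ⟨T, hT⟩
    by_cases hk : k ∈ T
    · rw [← extend_apply c' hT, hc'k T hk, map_zero]
    · have hcard : (insert k T).card = i + 1 + 1 := by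
        rw [Finset.card_insert_of_notMem hk, hT]
      have h := congrFun hdc' ⟨insert k T, hcard⟩
      rw [differential_eq_sum, Finset.sum_eq_single_of_mem k (Finset.mem_insert_self k T),
        Pi.zero_apply] at h
      · have h2 := congrArg (fun z =>
          (-1 : MvPolynomial (Fin n) K) ^ ((insert k T).filter (· < k)).card • z) h
        simp only [smul_smul, ← pow_add, Even.neg_one_pow ⟨_, rfl⟩, one_smul, smul_zero] at h2
        rw [res_extend_congr c' (Finset.erase_insert hk) _ (Finset.subset_insert k T),
          extend_apply c' hT] at h2
        exact h2
      · intro a _ hak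
        rw [hc'k _ (Finset.mem_erase.2 ⟨hak.symm, Finset.mem_insert_self k T⟩), map_zero,
          smul_zero]
  choose μ hμ using fun T => exists_X_pow_smul_eq_zero_of_res_eq_zero rfl _ _ (hres T)
  refine ⟨Finset.univ.sup μ + N, ?_⟩
  have hzero : (MvPolynomial.X k : MvPolynomial (Fin n) K) ^ (Finset.univ.sup μ) • c' = 0 := by
    funext T
    rw [Pi.smul_apply, ← Nat.sub_add_cancel (Finset.le_sup (f := μ) (Finset.mem_univ T)), pow_add,
      mul_smul, hμ, smul_zero, Pi.zero_apply]
  refine ⟨(MvPolynomial.X k : MvPolynomial (Fin n) K) ^ (Finset.univ.sup μ) • b, ?_⟩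
  rw [hc', smul_sub, sub_eq_zero] at hzero
  rw [map_smul, pow_add, mul_smul, hzero]

/-- The multipliers sending `c` to a coboundary form an ideal whose radical contains every variable,
hence every form of positive degree. -/
theorem exists_pow_smul_mem_coboundaries {i : ℕ} (c : Cochain K (n := n) M (i + 1))
    (hc : c ∈ cocycles K M (i + 1)) {l : MvPolynomial (Fin n) K} {D : ℕ} (hD : 1 ≤ D)
    (hl : l.IsHomogeneous D) : ∃ N : ℕ, l ^ N • c ∈ coboundaries K M (i + 1) := by
  let I : Ideal (MvPolynomial (Fin n) K) :=
    (coboundaries K M (i + 1)).comap (LinearMap.toSpanSingleton _ _ c)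
  have hI : ∀ f, f ∈ I ↔ f • c ∈ coboundaries K M (i + 1) := fun f => by
    simp [I, Submodule.mem_comap, LinearMap.toSpanSingleton_apply]
  have hX : Ideal.span (MvPolynomial.X '' (Set.univ : Set (Fin n))) ≤ I.radical := by
    rw [Ideal.span_le]
    rintro _ ⟨k, -, rfl⟩
    obtain ⟨N, hN⟩ := exists_X_pow_smul_mem_coboundaries c hc k
    exact ⟨N, (hI _).2 hN⟩
  have hlI : l ∈ I.radical := by
    refine hX (MvPolynomial.mem_ideal_span_X_image.2 fun m hm => ?_)
    by_contra! h
    have hm0 : m = 0 := Finsupp.ext fun k => h k trivial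
    have := hl (MvPolynomial.mem_support_iff.1 hm)
    simp [hm0] at this
    omega
  obtain ⟨N, hN⟩ := hlI
  exact ⟨N, (hI _).1 hN⟩

end Cochains

end GradedLocalCohomology

namespace GradedLocalCohomology

/-! ### Homogeneous components, and injectivity of `l` on cochains -/

section GradedPieces

variable {K : Type*} [Field K] {n : ℕ} {M : Type*} [AddCommGroup M]
  [Module (MvPolynomial (Fin n) K) M] {ℳ : ℤ → AddSubgroup M}

/-- The projection of a graded module to its degree `i` part. -/
noncomputable def IsGradedModule.proj (hℳ : IsGradedModule (K := K) (n := n) ℳ) (i : ℤ) :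
    M →+ M :=
  letI := hℳ.isInternal.chooseDecomposition
  { toFun := fun m => (DirectSum.decompose ℳ m i : M)
    map_zero' := by simp
    map_add' := by simp }

namespace IsGradedModule

variable (hℳ : IsGradedModule (K := K) (n := n) ℳ)
include hℳ

theorem proj_mem (i : ℤ) (m : M) : hℳ.proj i m ∈ ℳ i :=
  let := hℳ.isInternal.chooseDecomposition
  (DirectSum.decompose ℳ m i).2

theorem proj_of_mem {i : ℤ} {m : M} (hm : m ∈ ℳ i) : hℳ.proj i m = m :=
  let := hℳ.isInternal.chooseDecomposition
  DirectSum.decompose_of_mem_same ℳ hm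

theorem proj_of_mem_ne {i j : ℤ} {m : M} (hm : m ∈ ℳ i) (hij : i ≠ j) : hℳ.proj j m = 0 :=
  let := hℳ.isInternal.chooseDecomposition
  DirectSum.decompose_of_mem_ne ℳ hm hij

theorem exists_sum_proj (m : M) : ∃ s : Finset ℤ, ∑ i ∈ s, hℳ.proj i m = m := by
  classical
  let := hℳ.isInternal.chooseDecomposition
  exact ⟨_, DirectSum.sum_support_decompose ℳ m⟩

theorem proj_smul {f : MvPolynomial (Fin n) K} {d : ℕ} (hf : f.IsHomogeneous d) (i : ℤ) (m : M) :
    hℳ.proj (i + d) (f • m) = f • hℳ.proj i m := by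
  let := hℳ.isInternal.chooseDecomposition
  induction m using DirectSum.Decomposition.inductionOn ℳ with
  | zero => simp
  | @homogeneous j m =>
    by_cases h : j = i
    · subst h
      rw [hℳ.proj_of_mem m.2, hℳ.proj_of_mem (hℳ.smul_mem d j f m hf m.2)]
    · rw [hℳ.proj_of_mem_ne m.2 h, smul_zero,
        hℳ.proj_of_mem_ne (hℳ.smul_mem d j f m hf m.2) (by omega)]
  | add m m' h h' => simp only [smul_add, map_add, h, h']

end IsGradedModule

section locProj

variable (hℳ : IsGradedModule (K := K) (n := n) ℳ)

/-- The projection of the localization `M_S` to its degree `j` part. -/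
noncomputable def locProj (S : Finset (Fin n)) (j : ℤ) (z : Loc K M S) : Loc K M S :=
  z.liftOn (fun p => LocalizedModule.mk (hℳ.proj (j + p.2.1.totalDegree) p.1) p.2) (by
    rintro ⟨m, s⟩ ⟨m', s'⟩ ⟨u, hu⟩
    obtain ⟨hs0, hs⟩ := exists_isHomogeneous_of_mem_monomials s.2
    obtain ⟨hs0', hs'⟩ := exists_isHomogeneous_of_mem_monomials s'.2
    obtain ⟨hu0, hu'⟩ := exists_isHomogeneous_of_mem_monomials u.2
    -- Independence of the chosen fraction: multiplication by the homogeneous elements `s`, `s'`,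
    -- `u` only shifts the projected degree, so both sides are the same component of the given
    -- equality.
    refine LocalizedModule.mk_eq.2 ⟨u, ?_⟩
    simp only [Submonoid.smul_def] at hu ⊢
    rw [← hℳ.proj_smul hs', ← hℳ.proj_smul hs, ← hℳ.proj_smul hu', ← hℳ.proj_smul hu', hu]
    congr 2
    ring)

theorem locProj_mk {S : Finset (Fin n)} (j : ℤ) (m : M) (s : monomials K S) {d : ℕ}
    (hs : (s : MvPolynomial (Fin n) K).IsHomogeneous d) :
    locProj hℳ S j (LocalizedModule.mk m s) = LocalizedModule.mk (hℳ.proj (j + d) m) s := by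
  rw [← hs.totalDegree (exists_isHomogeneous_of_mem_monomials s.2).1]
  exact LocalizedModule.liftOn_mk _ _ _

theorem locProj_add {S : Finset (Fin n)} (j : ℤ) (z w : Loc K M S) :
    locProj hℳ S j (z + w) = locProj hℳ S j z + locProj hℳ S j w := by
  induction z, w using LocalizedModule.induction_on₂ with
  | h m m' s s' =>
    have hs := (exists_isHomogeneous_of_mem_monomials s.2).2
    have hs' := (exists_isHomogeneous_of_mem_monomials s'.2).2
    rw [LocalizedModule.mk_add_mk, locProj_mk hℳ j _ _ (d := _ + _) (hs.mul hs'),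
      locProj_mk hℳ j _ _ hs, locProj_mk hℳ j _ _ hs', LocalizedModule.mk_add_mk, map_add]
    simp only [Submonoid.smul_def]
    rw [← hℳ.proj_smul hs', ← hℳ.proj_smul hs]
    push_cast
    rw [add_assoc, add_assoc, add_comm (s'.1.totalDegree : ℤ)]

theorem locProj_smul {S : Finset (Fin n)} (j : ℤ) {f : MvPolynomial (Fin n) K} {d : ℕ}
    (hf : f.IsHomogeneous d) (z : Loc K M S) :
    locProj hℳ S (j + d) (f • z) = f • locProj hℳ S j z := by
  induction z using LocalizedModule.induction_on with
  | h m s =>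
    have hs := (exists_isHomogeneous_of_mem_monomials s.2).2
    rw [LocalizedModule.smul'_mk, locProj_mk hℳ _ _ _ hs, locProj_mk hℳ _ _ _ hs,
      LocalizedModule.smul'_mk, ← hℳ.proj_smul hf, add_right_comm]

theorem locProj_res {S T : Finset (Fin n)} (h : S ⊆ T) (j : ℤ) (z : Loc K M S) :
    locProj hℳ T j (res K M h z) = res K M h (locProj hℳ S j z) := by
  induction z using LocalizedModule.induction_on with
  | h m s =>
    have hs := (exists_isHomogeneous_of_mem_monomials s.2).2
    rw [res_mk, locProj_mk hℳ _ _ _ hs, locProj_mk hℳ _ _ ⟨s.1, monomials_mono K h s.2⟩ hs,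
      res_mk]

theorem isHomogeneousLoc_locProj {S : Finset (Fin n)} (j : ℤ) (z : Loc K M S) :
    IsHomogeneousLoc ℳ S j (locProj hℳ S j z) := by
  induction z using LocalizedModule.induction_on with
  | h m s =>
    have hs := (exists_isHomogeneous_of_mem_monomials s.2).2
    exact ⟨_, s, _, hs, hℳ.proj_mem _ m, locProj_mk hℳ _ _ _ hs⟩

theorem locProj_eq_self {S : Finset (Fin n)} {j : ℤ} {z : Loc K M S}
    (hz : IsHomogeneousLoc ℳ S j z) : locProj hℳ S j z = z := by
  obtain ⟨d, s, m, hs, hm, rfl⟩ := hz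
  rw [locProj_mk hℳ _ _ _ hs, hℳ.proj_of_mem hm]

/-- The projection of Čech cochains to their degree `j` part. -/
noncomputable def cochainProj (i : ℕ) (j : ℤ) :
    Cochain K (n := n) M i →+ Cochain K (n := n) M i :=
  AddMonoidHom.mk' (fun c S => locProj hℳ S.1 j (c S)) fun c c' =>
    funext fun S => locProj_add hℳ j (c S) (c' S)

theorem cochainProj_apply {i : ℕ} (j : ℤ) (c : Cochain K (n := n) M i)
    (S : {S : Finset (Fin n) // S.card = i}) :
    cochainProj hℳ i j c S = locProj hℳ S.1 j (c S) := rfl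

theorem cochainProj_smul {i : ℕ} (j : ℤ) {f : MvPolynomial (Fin n) K} {d : ℕ}
    (hf : f.IsHomogeneous d) (c : Cochain K (n := n) M i) :
    cochainProj hℳ i (j + d) (f • c) = f • cochainProj hℳ i j c :=
  funext fun S => locProj_smul hℳ j hf (c S)

theorem isHomogeneousCochain_cochainProj {i : ℕ} (j : ℤ) (c : Cochain K (n := n) M i) :
    IsHomogeneousCochain ℳ j (cochainProj hℳ i j c) :=
  fun S => isHomogeneousLoc_locProj hℳ j (c S)

/-- Replaces the choice of fractions by a fixed-point equation for an additive map, so that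
homogeneity can be checked by algebra. -/
theorem isHomogeneousCochain_iff {i : ℕ} {j : ℤ} {c : Cochain K (n := n) M i} :
    IsHomogeneousCochain ℳ j c ↔ cochainProj hℳ i j c = c :=
  ⟨fun h => funext fun S => locProj_eq_self hℳ (h S), fun h => by
    rw [← h]; exact isHomogeneousCochain_cochainProj hℳ j c⟩

theorem cochainProj_differential {i : ℕ} (j : ℤ) (c : Cochain K (n := n) M i) :
    cochainProj hℳ (i + 1) j (differential K M i c) =
      differential K M i (cochainProj hℳ i j c) := by
  funext T
  let P : Loc K M T.1 →+ Loc K M T.1 := AddMonoidHom.mk' (locProj hℳ T.1 j) (locProj_add hℳ j)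
  have hP : ∀ z, locProj hℳ T.1 j z = P z := fun _ => rfl
  rw [cochainProj_apply, differential_apply, differential_apply, hP, map_sum]
  refine Finset.sum_congr rfl fun k _ => ?_
  have hsign : ((-1 : MvPolynomial (Fin n) K) ^ (T.1.filter (· < k.1)).card).IsHomogeneous 0 := by
    simpa using ((MvPolynomial.isHomogeneous_one (Fin n) K).neg).pow
      (T.1.filter (· < k.1)).card
  rw [← hP, cochainProj_apply, ← locProj_res]
  simpa using locProj_smul hℳ j hsign _

include hℳ in
theorem isHomogeneousCochain_smul {i : ℕ} {j : ℤ} {f : MvPolynomial (Fin n) K} {d : ℕ}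
    (hf : f.IsHomogeneous d) {c : Cochain K (n := n) M i} (hc : IsHomogeneousCochain ℳ j c) :
    IsHomogeneousCochain ℳ (j + d) (f • c) := by
  rw [isHomogeneousCochain_iff hℳ] at hc ⊢
  rw [cochainProj_smul hℳ j hf, hc]

include hℳ in
/-- A filter regular element acts injectively on the localizations at nonempty sets of
variables. -/
theorem smul_injective_of_isFilterRegular {l : MvPolynomial (Fin n) K} {D : ℕ}
    (hl : IsFilterRegular ℳ l D) {S : Finset (Fin n)} (hS : S.Nonempty) {z : Loc K M S}
    (hz : l • z = 0) : z = 0 := by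
  obtain ⟨k, hk⟩ := hS
  obtain ⟨hlD, hev⟩ := hl
  obtain ⟨a, ha⟩ := Filter.eventually_atTop.1 hev
  induction z using LocalizedModule.induction_on with
  | h m s =>
    rw [LocalizedModule.smul'_mk, mk_eq_zero_iff] at hz
    obtain ⟨t, ht, h⟩ := hz
    rw [smul_smul, mul_comm, ← smul_smul] at h
    have hproj : ∀ i, ∃ N : ℕ,
        (MvPolynomial.X k : MvPolynomial (Fin n) K) ^ N • hℳ.proj i (t • m) = 0 := by
      intro i
      -- This power of `X_k` pushes the degree `i` component into degrees at least `a`, where `l` is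
      -- injective.
      refine ⟨(a - i).toNat, ?_⟩
      set N := (a - i).toNat
      have hX : ((MvPolynomial.X k : MvPolynomial (Fin n) K) ^ N).IsHomogeneous N := by
        simpa using (MvPolynomial.isHomogeneous_X K k).pow N
      have hN : a ≤ i + N := by omega
      refine ha (i + N + D) (by omega) ?_ (zero_mem _) ?_
      · rw [add_sub_cancel_right]
        exact hℳ.smul_mem _ _ _ _ hX (hℳ.proj_mem i _)
      · simp only [smul_zero]
        rw [smul_comm, ← hℳ.proj_smul hlD, h, map_zero, smul_zero]
    choose ν hν using hproj
    obtain ⟨I, hI⟩ := hℳ.exists_sum_proj (t • m)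
    rw [mk_eq_zero_iff]
    refine ⟨MvPolynomial.X k ^ (I.sup ν) * t,
      mul_mem (pow_mem (X_mem_monomials hk) _) ht, ?_⟩
    rw [mul_smul, ← hI, Finset.smul_sum]
    refine Finset.sum_eq_zero fun i hi => ?_
    rw [← Nat.sub_add_cancel (Finset.le_sup (f := ν) hi), pow_add, mul_smul, hν, smul_zero]

include hℳ in
theorem cochain_smul_injective_of_isFilterRegular {l : MvPolynomial (Fin n) K} {D : ℕ}
    (hl : IsFilterRegular ℳ l D) {i : ℕ} {c : Cochain K (n := n) M (i + 1)}
    (hc : l • c = 0) : c = 0 := by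
  funext S
  refine smul_injective_of_isFilterRegular hℳ hl ?_ (congrFun hc S)
  rw [← Finset.card_pos, S.2]
  omega

end locProj

end GradedPieces

/-! ### Čech cochains of `M/lM` -/

section Quotient

variable {K : Type*} [Field K] {n : ℕ} {M N : Type*} [AddCommGroup M]
  [Module (MvPolynomial (Fin n) K) M] [AddCommGroup N] [Module (MvPolynomial (Fin n) K) N]

/-- The map induced on Čech cochains by a linear map. -/
noncomputable def cochainMap (f : M →ₗ[MvPolynomial (Fin n) K] N) (i : ℕ) :
    Cochain K (n := n) M i →ₗ[MvPolynomial (Fin n) K] Cochain K (n := n) N i :=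
  LinearMap.pi fun S => locMap f S.1 ∘ₗ LinearMap.proj S

theorem cochainMap_apply (f : M →ₗ[MvPolynomial (Fin n) K] N) {i : ℕ}
    (c : Cochain K (n := n) M i) (S : {S : Finset (Fin n) // S.card = i}) :
    cochainMap f i c S = locMap f S.1 (c S) := rfl

theorem cochainMap_differential (f : M →ₗ[MvPolynomial (Fin n) K] N) {i : ℕ}
    (c : Cochain K (n := n) M i) :
    cochainMap f (i + 1) (differential K M i c) = differential K N i (cochainMap f i c) := by
  funext T
  rw [cochainMap_apply, differential_apply, differential_apply, map_sum]
  refine Finset.sum_congr rfl fun k _ => ?_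
  rw [map_smul, locMap_res, cochainMap_apply]

theorem cochainMap_surjective {f : M →ₗ[MvPolynomial (Fin n) K] N}
    (hf : Function.Surjective f) (i : ℕ) : Function.Surjective (cochainMap f i) := by
  intro c
  choose b hb using fun S : {S : Finset (Fin n) // S.card = i} => locMap_surjective hf S.1 (c S)
  exact ⟨b, funext hb⟩

theorem cochainMap_mem_coboundaries (f : M →ₗ[MvPolynomial (Fin n) K] N) {i : ℕ}
    {c : Cochain K (n := n) M i} (hc : c ∈ coboundaries K M i) :
    cochainMap f i c ∈ coboundaries K N i := by
  cases i with
  | zero => rw [(Submodule.mem_bot _).1 hc, map_zero]; exact zero_mem _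
  | succ i =>
    obtain ⟨b, rfl⟩ := hc
    exact ⟨cochainMap f i b, (cochainMap_differential f b).symm⟩

theorem exists_mem_coboundaries_cochainMap_eq {f : M →ₗ[MvPolynomial (Fin n) K] N}
    (hf : Function.Surjective f) {i : ℕ} {c : Cochain K (n := n) N i}
    (hc : c ∈ coboundaries K N i) : ∃ b ∈ coboundaries K M i, cochainMap f i b = c := by
  cases i with
  | zero => exact ⟨0, zero_mem _, by rw [(Submodule.mem_bot _).1 hc, map_zero]⟩
  | succ i =>
    obtain ⟨e, rfl⟩ := hc
    obtain ⟨e, rfl⟩ := cochainMap_surjective hf i e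
    exact ⟨differential K M i e, ⟨e, rfl⟩, cochainMap_differential f e⟩

theorem coboundaries_le_cocycles (i : ℕ) :
    coboundaries K (n := n) M i ≤ cocycles K M i := by
  cases i with
  | zero => exact bot_le
  | succ i =>
    rintro _ ⟨e, rfl⟩
    exact differential_differential e

theorem cochainMap_mkQ_eq_zero_iff (l : MvPolynomial (Fin n) K) {i : ℕ}
    (c : Cochain K (n := n) M i) :
    cochainMap (l • (⊤ : Submodule (MvPolynomial (Fin n) K) M)).mkQ i c = 0 ↔
      ∃ f, c = l • f := by
  constructor
  · intro h
    choose f hf using fun S => (locMap_mkQ_eq_zero_iff l (c S)).1 (congrFun h S)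
    exact ⟨f, funext hf⟩
  · rintro ⟨f, rfl⟩
    exact funext fun S => (locMap_mkQ_eq_zero_iff l _).2 ⟨f S, rfl⟩

variable {ℳ : ℤ → AddSubgroup M}

theorem IsHomogeneousCochain.cochainMap_mkQ (P : Submodule (MvPolynomial (Fin n) K) M) {i : ℕ}
    {j : ℤ} {c : Cochain K (n := n) M i} (hc : IsHomogeneousCochain ℳ j c) :
    IsHomogeneousCochain (quotientGrading ℳ P) j (cochainMap P.mkQ i c) := by
  intro S
  obtain ⟨d, s, m, hs, hm, h⟩ := hc S
  exact ⟨d, s, P.mkQ m, hs, ⟨m, hm, rfl⟩, by rw [cochainMap_apply, h, locMap_mk]⟩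

theorem IsHomogeneousCochain.exists_cochainMap_mkQ_eq
    {P : Submodule (MvPolynomial (Fin n) K) M} {i : ℕ}
    {j : ℤ} {c : Cochain K (n := n) (M ⧸ P) i}
    (hc : IsHomogeneousCochain (quotientGrading ℳ P) j c) :
    ∃ b : Cochain K (n := n) M i, IsHomogeneousCochain ℳ j b ∧ cochainMap P.mkQ i b = c := by
  have : ∀ S, ∃ z, IsHomogeneousLoc ℳ S.1 j z ∧ locMap P.mkQ S.1 z = c S := by
    intro S
    obtain ⟨d, s, _, hs, ⟨m, hm, rfl⟩, h⟩ := hc S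
    exact ⟨LocalizedModule.mk m s, ⟨d, s, m, hs, hm, rfl⟩, by rw [h, locMap_mk]; rfl⟩
  choose b hb hb' using this
  exact ⟨b, hb, funext hb'⟩

end Quotient

/-! ### The exact sequence in fixed degrees, and regularity -/

section Regularity

variable {K : Type*} [Field K] {n : ℕ} {M : Type*} [AddCommGroup M]
  [Module (MvPolynomial (Fin n) K) M] {ℳ : ℤ → AddSubgroup M}

theorem isRegularWrt_iff {𝒳 : Set ℕ} {m : ℤ} :
    IsRegularWrt K n ℳ 𝒳 m ↔ ∀ i ∈ 𝒳, ∀ j : ℤ, m - i < j →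
      ∀ c ∈ cocycles K (n := n) M i, IsHomogeneousCochain ℳ j c → c ∈ coboundaries K M i := by
  refine forall₄_congr fun i _ j _ => ?_
  constructor
  · intro h c hc hcj
    have := h _ ⟨⟨c, hc⟩, hcj, rfl⟩
    rwa [Submodule.Quotient.mk_eq_zero, Submodule.submoduleOf, Submodule.mem_comap] at this
  · rintro h _ ⟨c, hcj, rfl⟩
    rw [Submodule.Quotient.mk_eq_zero, Submodule.submoduleOf, Submodule.mem_comap]
    exact h c c.2 hcj

/-- If `H^i(M/lM)_{j + D} = 0`, then multiplication by the filter regular element `l` is injective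
on `H^{i+1}(M)_j`. -/
theorem mem_coboundaries_of_smul_mem (hℳ : IsGradedModule (K := K) (n := n) ℳ)
    {l : MvPolynomial (Fin n) K} {D : ℕ} (hl : IsFilterRegular ℳ l D) {i : ℕ} {j : ℤ}
    (h : ∀ c ∈ cocycles K (n := n) (M ⧸ l • (⊤ : Submodule (MvPolynomial (Fin n) K) M)) i,
      IsHomogeneousCochain (quotientGrading ℳ (l • ⊤)) (j + D) c → c ∈ coboundaries K _ i)
    {c : Cochain K (n := n) M (i + 1)} (hcj : IsHomogeneousCochain ℳ j c)
    (hlc : l • c ∈ coboundaries K M (i + 1)) : c ∈ coboundaries K M (i + 1) := by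
  obtain ⟨b, hb⟩ := hlc
  -- With `l • c = d b`, the degree `j + D` part of `b` becomes a cocycle modulo `l`, hence a
  -- coboundary, which lifts to a coboundary `e` over `M`. Their difference is `l • f`, and
  -- cancelling `l` gives `c = d f`.
  obtain ⟨e, he, hbe⟩ := exists_mem_coboundaries_cochainMap_eq (Submodule.mkQ_surjective _)
    (h (cochainMap _ i (cochainProj hℳ i (j + D) b)) (by
      rw [cocycles, LinearMap.mem_ker, ← cochainMap_differential, ← cochainProj_differential, hb,
        cochainMap_mkQ_eq_zero_iff, cochainProj_smul hℳ j hl.1]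
      exact ⟨_, rfl⟩) ((isHomogeneousCochain_cochainProj hℳ _ b).cochainMap_mkQ _))
  rw [eq_comm, ← sub_eq_zero, ← map_sub, cochainMap_mkQ_eq_zero_iff] at hbe
  obtain ⟨f, hf⟩ := hbe
  refine ⟨f, (sub_eq_zero.1 (cochain_smul_injective_of_isFilterRegular hℳ hl ?_)).symm⟩
  have hde := LinearMap.mem_ker.1 (coboundaries_le_cocycles i he)
  rw [smul_sub, ← map_smul, ← hf, map_sub, hde, sub_zero, ← cochainProj_differential, hb,
    cochainProj_smul hℳ j hl.1, (isHomogeneousCochain_iff hℳ).1 hcj, sub_self]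

theorem IsRegularWrt.of_quotient (hℳ : IsGradedModule (K := K) (n := n) ℳ)
    {l : MvPolynomial (Fin n) K} {D : ℕ} (hD : 1 ≤ D) (hl : IsFilterRegular ℳ l D)
    {𝒳 : Set ℕ} {m : ℤ}
    (h : IsRegularWrt K n
      (quotientGrading ℳ (l • (⊤ : Submodule (MvPolynomial (Fin n) K) M))) 𝒳 m) :
    IsRegularWrt K n ℳ ((· + 1) '' 𝒳) (m - D + 1) := by
  rw [isRegularWrt_iff] at h ⊢
  rintro _ ⟨i, hi, rfl⟩ j hj c hc hcj
  push_cast at hj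
  obtain ⟨N, hN⟩ := exists_pow_smul_mem_coboundaries c hc hD hl.1
  -- Passing from `c` to `l • c` raises the degree by `D`, which stays in the vanishing range, and
  -- lowers the power of `l` still needed.
  induction N generalizing j c with
  | zero => simpa using hN
  | succ N ih =>
    refine mem_coboundaries_of_smul_mem hℳ hl (h i hi (j + D) (by omega)) hcj ?_
    refine ih (j + D) _ (Submodule.smul_mem _ l hc)
      (isHomogeneousCochain_smul hℳ hl.1 hcj) (by omega) ?_
    rwa [smul_smul, ← pow_succ]

theorem IsRegularWrt.quotient (hℳ : IsGradedModule (K := K) (n := n) ℳ)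
    {l : MvPolynomial (Fin n) K} {D : ℕ} (hD : 1 ≤ D) (hl : IsFilterRegular ℳ l D)
    {𝒳 : Set ℕ} {m : ℤ} (h : IsRegularWrt K n ℳ (𝒳 ∪ (· + 1) '' 𝒳) m) :
    IsRegularWrt K n (quotientGrading ℳ (l • (⊤ : Submodule (MvPolynomial (Fin n) K) M)))
      𝒳 (m + D - 1) := by
  rw [isRegularWrt_iff] at h ⊢
  intro i hi j hj c hc hcj
  obtain ⟨c, hc_hom, rfl⟩ := hcj.exists_cochainMap_mkQ_eq
  rw [cocycles, LinearMap.mem_ker, ← cochainMap_differential, cochainMap_mkQ_eq_zero_iff] at hc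
  obtain ⟨f, hf⟩ := hc
  -- The connecting map: `c` lifts a cocycle of `M/lM`, so `d c` is divisible by `l`, and the
  -- quotient can be taken homogeneous of degree `j - D`.
  have hf' : differential K M i c = l • cochainProj hℳ (i + 1) (j - D) f := by
    rw [← cochainProj_smul hℳ (j - D) hl.1, ← hf, sub_add_cancel, cochainProj_differential,
      (isHomogeneousCochain_iff hℳ).1 hc_hom]
  obtain ⟨g, hg⟩ := h (i + 1) (Or.inr ⟨i, hi, rfl⟩) (j - D) (by push_cast; omega)
    (cochainProj hℳ (i + 1) (j - D) f) (by
      refine cochain_smul_injective_of_isFilterRegular hℳ hl ?_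
      rw [← map_smul, ← hf', differential_differential])
    (isHomogeneousCochain_cochainProj hℳ _ f)
  have hg' : differential K M i (cochainProj hℳ i (j - D) g) =
      cochainProj hℳ (i + 1) (j - D) f := by
    rw [← cochainProj_differential, hg,
      (isHomogeneousCochain_iff hℳ).1 (isHomogeneousCochain_cochainProj hℳ _ f)]
  -- Subtracting `l • g` makes the lift a cocycle without changing its image modulo `l`. The bound
  -- `j > m - i` uses `D ≥ 1`.
  have key := h i (Or.inl hi) j (by omega) (c - l • cochainProj hℳ i (j - D) g)
    (by rw [cocycles, LinearMap.mem_ker, map_sub, map_smul, hg', hf', sub_self])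
    (by
      rw [isHomogeneousCochain_iff hℳ, map_sub, (isHomogeneousCochain_iff hℳ).1 hc_hom]
      have := isHomogeneousCochain_smul hℳ hl.1
        (isHomogeneousCochain_cochainProj hℳ (j - D) g)
      rw [sub_add_cancel] at this
      rw [(isHomogeneousCochain_iff hℳ).1 this])
  have := cochainMap_mem_coboundaries (l • (⊤ : Submodule (MvPolynomial (Fin n) K) M)).mkQ key
  rwa [map_sub, (cochainMap_mkQ_eq_zero_iff l _).2 ⟨_, rfl⟩, sub_zero] at this

theorem IsRegularWrt.mono {𝒳 𝒴 : Set ℕ} (h𝒳 : 𝒳 ⊆ 𝒴) {m : ℤ} (h : IsRegularWrt K n ℳ 𝒴 m) :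
    IsRegularWrt K n ℳ 𝒳 m := fun i hi => h i (h𝒳 hi)

theorem regularity_le {𝒳 : Set ℕ} {m : ℤ} (h : IsRegularWrt K n ℳ 𝒳 m) :
    regularity K n ℳ 𝒳 ≤ ((m : ℝ) : EReal) := sInf_le ⟨m, h, rfl⟩

theorem le_regularity {𝒳 : Set ℕ} {a : EReal}
    (h : ∀ m : ℤ, IsRegularWrt K n ℳ 𝒳 m → a ≤ ((m : ℝ) : EReal)) :
    a ≤ regularity K n ℳ 𝒳 := le_sInf (by rintro _ ⟨m, hm, rfl⟩; exact h m hm)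

end Regularity

/-- The shift is by a finite number, so it moves across the inequality even at `±∞`. This isolates
the infimum on the right in the first bound. -/
theorem _root_.EReal.le_sub_natCast_add_one_iff {a b : EReal} (D : ℕ) :
    a ≤ b - (D : EReal) + 1 ↔ a + (D : EReal) - 1 ≤ b := by
  have hD : (D : EReal) = ((D : ℝ) : EReal) := rfl
  have h1 : (1 : EReal) = ((1 : ℝ) : EReal) := rfl
  have ht : (⊤ : EReal) - ((D : ℝ) : EReal) + ((1 : ℝ) : EReal) = ⊤ := rfl
  have ht' : (⊤ : EReal) + ((D : ℝ) : EReal) - ((1 : ℝ) : EReal) = ⊤ := rfl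
  rw [hD, h1]
  induction a <;> induction b <;> try simp only [ht, ht', le_top, top_le_iff, EReal.coe_ne_top]
  all_goals try simp
  · exact EReal.coe_ne_bot _
  · norm_cast
    constructor <;> intro h <;> linarith
  · exact EReal.coe_ne_top _

end GradedLocalCohomology

open GradedLocalCohomology in
theorem proposition4p5 {K : Type*} [Field K] (n : ℕ)
    {M : Type*} [AddCommGroup M] [Module (MvPolynomial (Fin n) K) M]
    [Module.Finite (MvPolynomial (Fin n) K) M]
    (ℳ : ℤ → AddSubgroup M) (hℳ : IsGradedModule (K := K) (n := n) ℳ)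
    (l : MvPolynomial (Fin n) K) (D : ℕ) (hD : 1 ≤ D) (hl : IsFilterRegular ℳ l D)
    (𝒳 : Set ℕ) (h𝒳 : 𝒳 ⊆ Set.Iic n) :
    regularity K n ℳ ((· + 1) '' 𝒳) ≤
        regularity K n (quotientGrading ℳ (l • (⊤ : Submodule (MvPolynomial (Fin n) K) M)))
          (𝒳 ∪ (· + 1) '' 𝒳) - (D : EReal) + 1 ∧
      regularity K n (quotientGrading ℳ (l • (⊤ : Submodule (MvPolynomial (Fin n) K) M)))
          𝒳 - (D : EReal) + 1 ≤
        regularity K n ℳ (𝒳 ∪ (· + 1) '' 𝒳) := by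
  constructor
  · rw [EReal.le_sub_natCast_add_one_iff]
    refine le_regularity fun m hm => ?_
    rw [← EReal.le_sub_natCast_add_one_iff]
    refine (regularity_le
      (IsRegularWrt.of_quotient hℳ hD hl (hm.mono Set.subset_union_left))).trans (le_of_eq ?_)
    push_cast
    rfl
  · refine le_regularity fun m hm => ?_
    have h := regularity_le (hm.quotient hℳ hD hl)
    calc _ ≤ (((m + D - 1 : ℤ) : ℝ) : EReal) - (D : EReal) + 1 :=
        add_le_add_left (EReal.sub_le_sub h le_rfl) 1
      _ = (((m + D - 1 : ℤ) : ℝ) - (D : ℝ) + 1 : ℝ) := rfl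
      _ = ((m : ℝ) : EReal) := by congr 1; push_cast; ring
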